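/- Let $\mathbb{T}^n=\mathbb{R}^n/\mathbb{Z}^n$ and $\widehat f(\xi)=\int_{\mathbb{T}^n}e^{-2\pi i x\cdot\xi}f(x)\,dx$ for $\xi\in\mathbb{Z}^n$. Given a real-valued phase function $\phi$ on $\mathbb{T}^n\times\mathbb{Z}^n$ (that is, $\phi(x,\xi)$ is $1$-periodic in $x$) and a function $a:\mathbb{T}^n\times\mathbb{Z}^n\to\mathbb{C}$, the Fourier series operator $A_{\phi,a}$ is $$A_{\phi,a}f(x)=\sum_{\xi\in\mathbb{Z}^n}e^{2\pi i\phi(x,\xi)}\,a(x,\xi)\,\widehat f(\xi),\qquad f\in C^\infty(\mathbb{T}^n).$$ We say that $A_{\phi,a}$ extends to a bounded operator on $L^p(\mathbb{T}^n)$ if, for every $f\in C^\infty(\mathbb{T}^n)$, this series converges (absolutely) at every $x$, and there is a bounded linear operator $T$ on $L^p(\mathbb{T}^n)$ with $Tf=A_{\phi,a}f$ almost everywhere for all $f\in C^\infty(\mathbb{T}^n)$. For a symbol $b:\mathbb{Z}^n\to\mathbb{C}$ that does not depend on $x$, let $\Vert b\Vert_{\mathfrak{S}_{\phi,p}}$ be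 the operator norm on $L^p(\mathbb{T}^n)$ of the bounded extension of $A_{\phi,b}$, and $\Vert b\Vert_{\mathfrak{S}_{\phi,p}}=\infty$ if there is no bounded extension. **Theorem.** Let $1<p<\infty$ and let $\phi:\mathbb{T}^n\times\mathbb{Z}^n\to\mathbb{R}$ be a phase function. Let $a:\mathbb{T}^n\times\mathbb{Z}^n\to\mathbb{C}$ be such that $a(\cdot,\xi)\in C^{[n/p]+1}(\mathbb{T}^n)$ for every $\xi\in\mathbb{Z}^n$, where $[\,\cdot\,]$ is the integer part, and $$\sup_{z\in\mathbb{T}^n}\Vert\partial_z^\alpha a(z,\cdot)\Vert_{\mathfrak{S}_{\phi,p}}<\infty\qquad\text{for every multi-index }\alpha\in\mathbb{N}_0^n\text{ with }|\alpha|\le[n/p]+1.$$ Then $A_{\phi,a}$ extends to a bounded linear operator $A_{\phi,a}:L^p(\mathbb{T}^n)\to L^p(\mathbb{T}^n)$. -/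

import Mathlib

open MeasureTheory
open scoped ENNReal ContDiff

noncomputable section

/-- The Lebesgue measure `dx` on `𝕋ⁿ = ℝⁿ/ℤⁿ`, of total mass `1`. -/
abbrev torusMeasure (n : ℕ) : Measure (UnitAddTorus (Fin n)) :=
  Measure.pi fun _ => AddCircle.haarAddCircle

/-- A function `g` on the torus `𝕋ⁿ = ℝⁿ/ℤⁿ` is of class `C^m`: the associated 1-periodic function
on `ℝⁿ` is of class `C^m`. -/
def TorusContDiff {n : ℕ} (m : WithTop ℕ∞) (g : UnitAddTorus (Fin n) → ℂ) : Prop :=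
  ContDiff ℝ m (fun x : Fin n → ℝ => g (fun i => (x i : UnitAddCircle)))

/-- The partial derivative `∂_{z_i} g` of a function on the torus. -/
def torusPartialDeriv {n : ℕ} (i : Fin n) (g : UnitAddTorus (Fin n) → ℂ) :
    UnitAddTorus (Fin n) → ℂ :=
  fun z => deriv (fun t : ℝ => g (z + Pi.single i (t : UnitAddCircle))) 0

/-- The derivative `∂^α g = ∂_{z_1}^{α_1} ⋯ ∂_{z_n}^{α_n} g` for a multi-index `α`. -/
def torusDeriv {n : ℕ} (α : Fin n → ℕ) (g : UnitAddTorus (Fin n) → ℂ) :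
    UnitAddTorus (Fin n) → ℂ :=
  (List.finRange n).foldr (fun i h => (torusPartialDeriv i)^[α i] h) g

/-- The term of index `ξ` of the series defining the Fourier series operator with phase `φ` and
symbol `a`, applied to `f` at the point `x`: `e^{2πiφ(x,ξ)} a(x,ξ) (𝓕f)(ξ)`. -/
def fsoTerm {n : ℕ} (φ : UnitAddTorus (Fin n) → (Fin n → ℤ) → ℝ)
    (a : UnitAddTorus (Fin n) → (Fin n → ℤ) → ℂ) (f : UnitAddTorus (Fin n) → ℂ)
    (x : UnitAddTorus (Fin n)) (ξ : Fin n → ℤ) : ℂ :=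
  Complex.exp (2 * Real.pi * Complex.I * φ x ξ) * a x ξ * UnitAddTorus.mFourierCoeff f ξ

/-- The bounded operator `T` on `L^p(𝕋ⁿ)` extends the Fourier series operator `A_{φ,a}`: for every
`f ∈ C^∞(𝕋ⁿ)`, the series `A_{φ,a}f(x) = ∑_ξ e^{2πiφ(x,ξ)} a(x,ξ) (𝓕f)(ξ)` converges at
every point `x`, and `T f` is the class of the function `A_{φ,a}f`. -/
def IsFSOExtension {n : ℕ} {p : ℝ≥0∞} [Fact (1 ≤ p)]
    (φ : UnitAddTorus (Fin n) → (Fin n → ℤ) → ℝ)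
    (a : UnitAddTorus (Fin n) → (Fin n → ℤ) → ℂ)
    (T : Lp ℂ p (torusMeasure n) →L[ℂ] Lp ℂ p (torusMeasure n)) : Prop :=
  ∀ f : C(UnitAddTorus (Fin n), ℂ), TorusContDiff ∞ f →
    (∀ x, Summable (fsoTerm φ a f x)) ∧
      T (ContinuousMap.toLp p (torusMeasure n) ℂ f) =ᵐ[torusMeasure n]
        fun x => ∑' ξ, fsoTerm φ a f x ξ

/-- The norm `‖b‖_{𝔖_{φ,p}}` of an `x`-independent symbol `b : ℤⁿ → ℂ`: the operator norm on
`L^p(𝕋ⁿ)` of the bounded extension of `A_{φ,b}`, and `∞` if there is no bounded extension (by the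
density of `C^∞(𝕋ⁿ)` the infimum is over at most one operator when `p < ∞`). -/
def fsoSymbolNorm {n : ℕ} (p : ℝ≥0∞) [Fact (1 ≤ p)]
    (φ : UnitAddTorus (Fin n) → (Fin n → ℤ) → ℝ) (b : (Fin n → ℤ) → ℂ) : ℝ≥0∞ :=
  ⨅ (T : Lp ℂ p (torusMeasure n) →L[ℂ] Lp ℂ p (torusMeasure n))
    (_ : IsFSOExtension φ (fun _ => b) T), ‖T‖ₑ

end

/-! The idea is to free the variable of the symbol. For a trigonometric polynomial f with
coefficients c, put F(x,z) = ∑ e^{2πiφ(x,ξ)} a(z,ξ) c(ξ), so that A_{φ,a}f(x) = F(x,x). With m =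
[n/p] one has m + 1 > n/p, and the Sobolev embedding in z bounds |F(x,x)|^p by a constant times the
sum of ∫ |∂_z^α F(x,z)|^p dz over |α| ≤ m + 1. After integrating in x and exchanging the integrals,
z is frozen inside: ∂_z^α F(·,z) is the operator with the x-independent symbol ∂_z^α a(z,·) applied
to f, and the hypothesis bounds its L^p norm uniformly in z. This is `lintegral_diagonal_le`,
resting on `enorm_rpow_le_sobolevSum`; `exists_eLpNorm_trigPoly_le` draws the conclusion for
A_{φ,a}.

The bound extends from trigonometric polynomials to L^p by density. For smooth f the extension
agrees with the series: the Fourier coefficients of f are summable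
(`summable_mFourierCoeff_of_torusContDiff`), so the Fourier series converges in L^p and can be
mapped term by term. Pointwise convergence at x is part of the hypothesis for α = 0, z = x.

The embedding is proved by hand: the fundamental theorem of calculus along rays from the corner of a
cube is iterated, each derivative gaining a power of the side length t, until Hölder's loss t^{-n/p}
becomes integrable. -/

/-! ### Differential calculus on the torus through periodic lifts -/

section TorusCalculus

variable {n : ℕ}

/-- The covering map `ℝⁿ → 𝕋ⁿ`. -/
def torusMk (x : Fin n → ℝ) : UnitAddTorus (Fin n) := fun i => (x i : UnitAddCircle)

theorem isOpenQuotientMap_torusMk : IsOpenQuotientMap (torusMk (n := n)) :=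
  IsOpenQuotientMap.piMap fun _ => QuotientAddGroup.isOpenQuotientMap_mk

theorem continuous_torusMk : Continuous (torusMk (n := n)) :=
  isOpenQuotientMap_torusMk.continuous

theorem surjective_torusMk : Function.Surjective (torusMk (n := n)) :=
  isOpenQuotientMap_torusMk.surjective

theorem torusMk_add (x y : Fin n → ℝ) : torusMk (x + y) = torusMk x + torusMk y := by
  ext i; simp [torusMk]

theorem torusMk_single (i : Fin n) (t : ℝ) :
    torusMk (Pi.single i t) = Pi.single i (t : UnitAddCircle) := by
  ext j
  by_cases h : j = i
  · subst h; simp [torusMk]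
  · simp [torusMk, h]

variable {m : WithTop ℕ∞} {g h : UnitAddTorus (Fin n) → ℂ}

theorem TorusContDiff.contDiff (hg : TorusContDiff m g) : ContDiff ℝ m (g ∘ torusMk) := hg

theorem TorusContDiff.of_le {m' : WithTop ℕ∞} (hg : TorusContDiff m g) (h : m' ≤ m) :
    TorusContDiff m' g := ContDiff.of_le hg h

theorem TorusContDiff.continuous (hg : TorusContDiff m g) : Continuous g :=
  isOpenQuotientMap_torusMk.isQuotientMap.continuous_iff.2 (ContDiff.continuous hg)

theorem TorusContDiff.differentiable (hg : TorusContDiff m g) (hm : 1 ≤ m) :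
    Differentiable ℝ (g ∘ torusMk) :=
  hg.contDiff.differentiable (by rintro rfl; simp at hm)

theorem TorusContDiff.sub (hg : TorusContDiff m g) (hh : TorusContDiff m h) :
    TorusContDiff m (fun z => g z - h z) := ContDiff.sub hg hh

theorem TorusContDiff.const_mul (c : ℂ) (hg : TorusContDiff m g) :
    TorusContDiff m (fun z => c * g z) := contDiff_const.mul hg.contDiff

theorem TorusContDiff.sum {ι : Type*} {s : Finset ι} {b : ι → UnitAddTorus (Fin n) → ℂ}
    (hb : ∀ ξ ∈ s, TorusContDiff m (b ξ)) : TorusContDiff m (fun z => ∑ ξ ∈ s, b ξ z) :=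
  ContDiff.sum hb

/-- The partial derivative on the torus is the directional derivative of the periodic lift. -/
theorem torusPartialDeriv_torusMk (i : Fin n) (hg : Differentiable ℝ (g ∘ torusMk))
    (x : Fin n → ℝ) :
    torusPartialDeriv i g (torusMk x) = fderiv ℝ (g ∘ torusMk) x (Pi.single i 1) := by
  have h1 : HasDerivAt (fun t : ℝ => x + t • (Pi.single i 1 : Fin n → ℝ))
      (Pi.single i 1) 0 := by
    simpa using ((hasDerivAt_id (0 : ℝ)).smul_const (Pi.single i 1 : Fin n → ℝ)).const_add x
  have h2 := HasFDerivAt.comp_hasDerivAt_of_eq (0 : ℝ) (hg x).hasFDerivAt h1 (by simp)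
  rw [← h2.deriv, torusPartialDeriv]
  congr 1
  ext t
  simp [torusMk_add, ← torusMk_single, ← Pi.single_smul]

theorem TorusContDiff.torusPartialDeriv {k : WithTop ℕ∞} (hg : TorusContDiff m g)
    (hk : k + 1 ≤ m) (i : Fin n) : TorusContDiff k (torusPartialDeriv i g) := by
  have hd := hg.differentiable (le_trans (by simp) hk)
  have : (_root_.torusPartialDeriv i g) ∘ torusMk =
      fun x => fderiv ℝ (g ∘ torusMk) x (Pi.single i 1) :=
    funext fun x => torusPartialDeriv_torusMk i hd x
  change ContDiff ℝ k (_root_.torusPartialDeriv i g ∘ torusMk)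
  rw [this]
  exact (hg.contDiff.fderiv_right hk).clm_apply contDiff_const

/-- Both sides lift to the second Fréchet derivative on ℝⁿ, which is symmetric. -/
theorem torusPartialDeriv_comm (hg : TorusContDiff 2 g) (i j : Fin n) :
    torusPartialDeriv i (torusPartialDeriv j g) = torusPartialDeriv j (torusPartialDeriv i g) := by
  have key : ∀ (i j : Fin n) (x : Fin n → ℝ),
      torusPartialDeriv i (torusPartialDeriv j g) (torusMk x) =
        fderiv ℝ (fderiv ℝ (g ∘ torusMk)) x (Pi.single i 1) (Pi.single j 1) := by
    intro i j x
    have hd := hg.differentiable (by norm_num)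
    have hj : TorusContDiff 1 (torusPartialDeriv j g) := hg.torusPartialDeriv (by norm_num) j
    rw [torusPartialDeriv_torusMk i (hj.differentiable le_rfl)]
    have : (torusPartialDeriv j g) ∘ torusMk =
        fun x => fderiv ℝ (g ∘ torusMk) x (Pi.single j 1) :=
      funext fun x => torusPartialDeriv_torusMk j hd x
    have h2 : DifferentiableAt ℝ (fderiv ℝ (g ∘ torusMk)) x :=
      ((hg.contDiff.fderiv_right (m := 1) (by norm_num)).differentiable (by norm_num)) x
    rw [this, fderiv_clm_apply h2 (by fun_prop)]
    simp
  ext z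
  obtain ⟨x, rfl⟩ := surjective_torusMk z
  rw [key, key]
  exact hg.contDiff.contDiffAt.isSymmSndFDerivAt (by simp) _ _

theorem differentiableAt_torus_single (hg : Differentiable ℝ (g ∘ torusMk)) (i : Fin n)
    (z : UnitAddTorus (Fin n)) :
    DifferentiableAt ℝ (fun t : ℝ => g (z + Pi.single i (t : UnitAddCircle))) 0 := by
  obtain ⟨x, rfl⟩ := surjective_torusMk z
  have : (fun t : ℝ => g (torusMk x + Pi.single i (t : UnitAddCircle))) =
      (g ∘ torusMk) ∘ fun t : ℝ => x + t • (Pi.single i 1 : Fin n → ℝ) := by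
    ext t
    simp [torusMk_add, ← torusMk_single, ← Pi.single_smul]
  rw [this]
  exact (hg _).comp _ (by fun_prop)

theorem torusPartialDeriv_sum_mul {ι : Type*} {s : Finset ι} {b : ι → UnitAddTorus (Fin n) → ℂ}
    (hb : ∀ ξ ∈ s, Differentiable ℝ (b ξ ∘ torusMk)) (c : ι → ℂ) (i : Fin n) :
    torusPartialDeriv i (fun z => ∑ ξ ∈ s, c ξ * b ξ z) =
      fun z => ∑ ξ ∈ s, c ξ * torusPartialDeriv i (b ξ) z := by
  ext z
  have h : ∀ ξ ∈ s, HasDerivAt (fun t : ℝ => c ξ * b ξ (z + Pi.single i (t : UnitAddCircle)))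
      (c ξ * torusPartialDeriv i (b ξ) z) 0 := fun ξ hξ =>
    (differentiableAt_torus_single (hb ξ hξ) i z).hasDerivAt.const_mul (c ξ)
  exact (HasDerivAt.fun_sum h).deriv

/-- The derivative of a function on the torus along a line. -/
theorem hasDerivAt_torusMk_line (hg : Differentiable ℝ (g ∘ torusMk)) (x y : Fin n → ℝ) (t : ℝ) :
    HasDerivAt (fun s : ℝ => g (torusMk (x + s • y)))
      (∑ i, y i * torusPartialDeriv i g (torusMk (x + t • y))) t := by
  have h1 : HasDerivAt (fun s : ℝ => x + s • y) y t := by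
    simpa using ((hasDerivAt_id t).smul_const y).const_add x
  refine ((hg (x + t • y)).hasFDerivAt.comp_hasDerivAt t h1).congr_deriv ?_
  conv_lhs => rw [pi_eq_sum_univ' y]
  simp_rw [torusPartialDeriv_torusMk _ hg, map_sum, map_smul, Complex.real_smul]
  refine Finset.sum_congr rfl fun i _ => ?_
  rw [← pi_eq_sum_univ' y]

/-- The iterated partial derivative along a list of coordinates. -/
noncomputable def listDeriv (l : List (Fin n)) (g : UnitAddTorus (Fin n) → ℂ) :
    UnitAddTorus (Fin n) → ℂ :=
  l.foldr torusPartialDeriv g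

theorem TorusContDiff.listDeriv {k : ℕ} : ∀ {l : List (Fin n)}
    (_ : TorusContDiff ((k + l.length : ℕ) : WithTop ℕ∞) g), TorusContDiff k (listDeriv l g)
  | [], hg => hg
  | i :: l, hg => by
    have : TorusContDiff ((k + 1 : ℕ) : WithTop ℕ∞) (_root_.listDeriv l g) :=
      TorusContDiff.listDeriv (by
        rw [show k + 1 + l.length = k + (i :: l).length by simp; omega]; exact hg)
    exact this.torusPartialDeriv (by norm_cast) i

/-- Permutations are generated by swaps of neighbours. At a swap, the derivative along the remaining
tail is still C², because g has as many derivatives as the whole list has entries. -/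
theorem listDeriv_perm {l₁ l₂ : List (Fin n)} (hl : l₁.Perm l₂)
    (hg : TorusContDiff (l₁.length : WithTop ℕ∞) g) : listDeriv l₁ g = listDeriv l₂ g := by
  induction hl with
  | nil => rfl
  | cons i _ ih =>
    have := ih (hg.of_le (by simp))
    simp only [listDeriv, List.foldr_cons] at this ⊢
    rw [this]
  | swap i j l =>
    have : TorusContDiff ((2 : ℕ) : WithTop ℕ∞) (listDeriv l g) :=
      TorusContDiff.listDeriv (by
        rw [show 2 + l.length = (i :: j :: l).length by simp; omega]; exact hg)
    exact torusPartialDeriv_comm this _ _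
  | trans h _ ih₁ ih₂ => exact (ih₁ hg).trans (ih₂ (h.length_eq ▸ hg))

theorem torusDeriv_eq_listDeriv (α : Fin n → ℕ) (g : UnitAddTorus (Fin n) → ℂ) :
    torusDeriv α g =
      listDeriv ((List.finRange n).flatMap fun i => List.replicate (α i) i) g := by
  unfold torusDeriv
  generalize List.finRange n = L
  induction L with
  | nil => rfl
  | cons i L ih =>
    simp only [List.foldr_cons, List.flatMap_cons, listDeriv, List.foldr_append] at ih ⊢
    rw [ih]
    generalize List.foldr torusPartialDeriv g _ = w
    generalize α i = k
    induction k with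
    | zero => rfl
    | succ k ihk => rw [Function.iterate_succ_apply', ihk, List.replicate_succ, List.foldr_cons]

/-- A derivative along a list is the derivative along the multi-index counting its entries. -/
theorem listDeriv_eq_torusDeriv {l : List (Fin n)}
    (hg : TorusContDiff (l.length : WithTop ℕ∞) g) :
    listDeriv l g = torusDeriv (fun i => l.count i) g := by
  rw [torusDeriv_eq_listDeriv]
  refine listDeriv_perm (List.perm_iff_count.2 fun i => ?_) hg
  rw [List.count_flatMap]
  simp only [Function.comp_def, List.count_replicate]
  rw [← List.ofFn_eq_map, List.sum_ofFn]
  simp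

theorem sum_count_eq_length (l : List (Fin n)) : ∑ i, l.count i = l.length := by
  simpa using Multiset.sum_count_eq_card (s := Finset.univ) (m := (l : Multiset (Fin n))) (by simp)

end TorusCalculus

/-! ### The Sobolev embedding on the torus -/

section Sobolev

variable {n : ℕ}

/-- The half-open unit cube, a fundamental domain of the torus. -/
def unitCube (n : ℕ) : Set (Fin n → ℝ) := {y | ∀ i, y i ∈ Set.Ioc (0 : ℝ) (0 + 1)}

theorem unitCube_eq_pi : unitCube n = Set.univ.pi fun _ => Set.Ioc (0 : ℝ) 1 := by
  ext; simp [unitCube]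

theorem measurableSet_unitCube : MeasurableSet (unitCube n) := by
  rw [unitCube_eq_pi]
  exact MeasurableSet.univ_pi fun _ => measurableSet_Ioc

theorem volume_unitCube : volume (unitCube n) = 1 := by
  rw [unitCube_eq_pi, volume_pi_pi]
  simp

instance : IsProbabilityMeasure (volume.restrict (unitCube n)) :=
  ⟨by rw [Measure.restrict_apply_univ, volume_unitCube]⟩

theorem setLIntegral_unitCube (F : UnitAddTorus (Fin n) → ℝ≥0∞) (x : Fin n → ℝ) :
    ∫⁻ y in unitCube n, F (torusMk (x + y)) = ∫⁻ z, F z ∂torusMeasure n := by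
  rw [← lintegral_add_left_eq_self F (torusMk x)]
  simp_rw [torusMk_add]
  exact (UnitAddTorus.lintegral_preimage (fun z => F (torusMk x + z)) 0).symm

theorem smul_mem_unitCube {t : ℝ} (ht : t ∈ Set.Ioc (0 : ℝ) 1) {y : Fin n → ℝ}
    (hy : y ∈ unitCube n) : t • y ∈ unitCube n := fun i => by
  have := hy i
  simp only [zero_add, Set.mem_Ioc, Pi.smul_apply, smul_eq_mul] at this ht ⊢
  exact ⟨mul_pos ht.1 this.1, mul_le_one₀ ht.2 this.1.le this.2⟩

/-- The dilate of the cube by t ≤ 1 stays inside the cube, and the change of variables costs the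
Jacobian t^{-n}. -/
theorem setLIntegral_unitCube_comp_smul_le (F : (Fin n → ℝ) → ℝ≥0∞) {t : ℝ}
    (ht : t ∈ Set.Ioc (0 : ℝ) 1) :
    ∫⁻ y in unitCube n, F (t • y) ≤ ENNReal.ofReal ((t ^ n)⁻¹) * ∫⁻ y in unitCube n, F y := by
  calc ∫⁻ y in unitCube n, F (t • y)
      = ∫⁻ y, (unitCube n).indicator (fun y => F (t • y)) y :=
        (lintegral_indicator measurableSet_unitCube _).symm
    _ ≤ ∫⁻ y, (unitCube n).indicator F (t • y) := by
        refine lintegral_mono fun y => ?_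
        by_cases hy : y ∈ unitCube n
        · rw [Set.indicator_of_mem hy, Set.indicator_of_mem (smul_mem_unitCube ht hy)]
        · rw [Set.indicator_of_notMem hy]; exact zero_le
    _ = ∫⁻ y, (unitCube n).indicator F y ∂(Measure.map (t • ·) volume) :=
        ((measurableEmbedding_const_smul₀ ht.1.ne').lintegral_map _).symm
    _ = _ := by
        rw [Measure.map_addHaar_smul _ ht.1.ne', lintegral_smul_measure,
          lintegral_indicator measurableSet_unitCube, abs_of_nonneg (by have := ht.1; positivity)]
        simp

/-- The mean of `|g|` over the cube with corner `x` and side length `t`. -/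
noncomputable def cubeMean (g : UnitAddTorus (Fin n) → ℂ) (x : Fin n → ℝ) (t : ℝ) : ℝ≥0∞ :=
  ∫⁻ y in unitCube n, ‖g (torusMk (x + t • y))‖ₑ

variable {g : UnitAddTorus (Fin n) → ℂ}

theorem continuous_torusMk_line (x : Fin n → ℝ) :
    Continuous fun q : ℝ × (Fin n → ℝ) => torusMk (x + q.1 • q.2) :=
  continuous_torusMk.comp (by fun_prop)

theorem measurable_cubeMean (hg : Continuous g) (x : Fin n → ℝ) : Measurable (cubeMean g x) :=
  Measurable.lintegral_prod_right' (f := fun q : ℝ × (Fin n → ℝ) =>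
    ‖g (torusMk (x + q.1 • q.2))‖ₑ) (hg.comp (continuous_torusMk_line x)).enorm.measurable

theorem cubeMean_zero (x : Fin n → ℝ) : cubeMean g x 0 = ‖g (torusMk x)‖ₑ := by
  simp [cubeMean]

/-- Hölder on a probability space raises the exponent from 1 to q; the q-th root of the Jacobian
t^{-n} is the factor t^{-n/q}. -/
theorem cubeMean_le_eLpNorm' (hg : Continuous g) (x : Fin n → ℝ) {q : ℝ} (hq : 1 ≤ q) {t : ℝ}
    (ht : t ∈ Set.Ioc (0 : ℝ) 1) :
    cubeMean g x t ≤ ENNReal.ofReal (t ^ (-(n / q))) * eLpNorm' g q (torusMeasure n) := by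
  have hq0 : 0 < q := by linarith
  have hc : Continuous fun y : Fin n → ℝ => g (torusMk (x + t • y)) :=
    hg.comp (continuous_torusMk.comp (by fun_prop))
  have h1 := eLpNorm'_le_eLpNorm'_of_exponent_le (μ := volume.restrict (unitCube n))
    one_pos hq hc.aestronglyMeasurable
  simp only [eLpNorm', ENNReal.rpow_one, div_one] at h1
  refine h1.trans ?_
  calc (∫⁻ y in unitCube n, ‖g (torusMk (x + t • y))‖ₑ ^ q) ^ (1 / q)
      ≤ (ENNReal.ofReal ((t ^ n)⁻¹) * ∫⁻ z, ‖g z‖ₑ ^ q ∂torusMeasure n) ^ (1 / q) := by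
        gcongr
        rw [← setLIntegral_unitCube _ x]
        exact setLIntegral_unitCube_comp_smul_le (fun y => ‖g (torusMk (x + y))‖ₑ ^ q) ht
    _ = _ := by
        have := ht.1
        rw [ENNReal.mul_rpow_of_nonneg _ _ (by positivity), eLpNorm',
          ENNReal.ofReal_rpow_of_nonneg (by positivity) (by positivity)]
        congr 2
        rw [← Real.rpow_natCast, ← Real.rpow_neg this.le, ← Real.rpow_mul this.le]
        ring_nf

theorem cubeMean_one_le_eLpNorm' (hg : Continuous g) (x : Fin n → ℝ) {q : ℝ} (hq : 1 ≤ q) :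
    cubeMean g x 1 ≤ eLpNorm' g q (torusMeasure n) := by
  simpa using cubeMean_le_eLpNorm' hg x hq (t := 1) (by simp)

/-- The fundamental theorem of calculus along the rays issued from the corner of the cube. -/
theorem cubeMean_le (hg : TorusContDiff 1 g) (x : Fin n → ℝ) {t : ℝ} (ht : t ≤ 1) :
    cubeMean g x t ≤
      cubeMean g x 1 + ∫⁻ s in Set.Ioc t 1, ∑ i, cubeMean (torusPartialDeriv i g) x s := by
  have hd := hg.differentiable le_rfl
  have hc : ∀ i, Continuous (torusPartialDeriv i g) := fun i =>
    (hg.torusPartialDeriv (k := 0) (by simp) i).continuous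
  have hline := continuous_torusMk_line x
  have pointwise : ∀ y ∈ unitCube n, ‖g (torusMk (x + t • y))‖ₑ ≤
      ‖g (torusMk (x + (1 : ℝ) • y))‖ₑ +
        ∫⁻ s in Set.Ioc t 1, ∑ i, ‖torusPartialDeriv i g (torusMk (x + s • y))‖ₑ := by
    intro y hy
    have hcont : Continuous fun s : ℝ =>
        ∑ i, (y i : ℂ) * torusPartialDeriv i g (torusMk (x + s • y)) := by
      refine continuous_finsetSum _ fun i _ => continuous_const.mul ?_
      exact (hc i).comp (continuous_torusMk.comp (by fun_prop))
    have ftc := intervalIntegral.integral_eq_sub_of_hasDerivAt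
      (fun s _ => hasDerivAt_torusMk_line hd x y s) (hcont.intervalIntegrable t 1)
    have e : g (torusMk (x + t • y)) = g (torusMk (x + (1 : ℝ) • y)) -
        ∫ s in t..1, ∑ i, (y i : ℂ) * torusPartialDeriv i g (torusMk (x + s • y)) := by
      rw [ftc]; ring
    rw [e, intervalIntegral.integral_of_le ht]
    refine (enorm_sub_le).trans (add_le_add le_rfl ?_)
    refine (enorm_integral_le_lintegral_enorm _).trans (lintegral_mono fun s => ?_)
    refine (enorm_sum_le _ _).trans (Finset.sum_le_sum fun i _ => ?_)
    rw [enorm_mul]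
    refine mul_le_of_le_one_left zero_le ?_
    have := hy i
    simp only [zero_add, Set.mem_Ioc] at this
    rw [← ofReal_norm, Complex.norm_real, Real.norm_of_nonneg this.1.le]
    exact ENNReal.ofReal_le_one.2 this.2
  have hm : Measurable (Function.uncurry fun (y : Fin n → ℝ) (s : ℝ) =>
      ∑ i, ‖torusPartialDeriv i g (torusMk (x + s • y))‖ₑ) :=
    Finset.measurable_sum _ fun i _ =>
      ((hc i).comp (hline.comp continuous_swap)).enorm.measurable
  calc cubeMean g x t ≤ ∫⁻ y in unitCube n, (‖g (torusMk (x + (1 : ℝ) • y))‖ₑ +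
        ∫⁻ s in Set.Ioc t 1, ∑ i, ‖torusPartialDeriv i g (torusMk (x + s • y))‖ₑ) :=
        setLIntegral_mono' measurableSet_unitCube pointwise
    _ = cubeMean g x 1 + ∫⁻ y in unitCube n,
        ∫⁻ s in Set.Ioc t 1, ∑ i, ‖torusPartialDeriv i g (torusMk (x + s • y))‖ₑ := by
        refine lintegral_add_left ?_ _
        exact (hg.continuous.comp (continuous_torusMk.comp (by fun_prop))).enorm.measurable
    _ = _ := by
        rw [lintegral_lintegral_swap hm.aemeasurable]
        congr 1
        refine lintegral_congr fun s => ?_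
        rw [lintegral_finsetSum]
        · rfl
        · exact fun i _ =>
            ((hc i).comp (continuous_torusMk.comp (by fun_prop))).enorm.measurable

/-- A weighted integral of the means of `|g|` over cubes with corner `x`. -/
noncomputable def weightedMean (j : ℕ) (g : UnitAddTorus (Fin n) → ℂ) (x : Fin n → ℝ) : ℝ≥0∞ :=
  ∫⁻ t in Set.Ioc (0 : ℝ) 1, ENNReal.ofReal (t ^ j) * cubeMean g x t

/-- By Tonelli on the region t < s, the weight of F(s) is at most ∫₀^s t^j dt ≤ s^j · s. This is the
gain of one power per derivative. -/
theorem lintegral_pow_mul_tail_le (j : ℕ) {F : ℝ → ℝ≥0∞} (hF : Measurable F) :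
    ∫⁻ t in Set.Ioc (0 : ℝ) 1, ENNReal.ofReal (t ^ j) * ∫⁻ s in Set.Ioc t 1, F s ≤
      ∫⁻ s in Set.Ioc (0 : ℝ) 1, ENNReal.ofReal (s ^ (j + 1)) * F s := by
  have hS : MeasurableSet {q : ℝ × ℝ | q.1 < q.2} :=
    measurableSet_lt measurable_fst measurable_snd
  -- The integrand on the triangle t < s, extended by zero so that both integrals run over a fixed
  -- interval.
  set K : ℝ × ℝ → ℝ≥0∞ := {q : ℝ × ℝ | q.1 < q.2}.indicator
    fun q => ENNReal.ofReal (q.1 ^ j) * F q.2 with hK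
  have hKm : Measurable K := by
    refine Measurable.indicator ?_ hS
    exact (by fun_prop : Measurable fun q : ℝ × ℝ => ENNReal.ofReal (q.1 ^ j)).mul
      (hF.comp measurable_snd)
  calc ∫⁻ t in Set.Ioc (0 : ℝ) 1, ENNReal.ofReal (t ^ j) * ∫⁻ s in Set.Ioc t 1, F s
      ≤ ∫⁻ t in Set.Ioc (0 : ℝ) 1, ∫⁻ s in Set.Ioc (0 : ℝ) 1, K (t, s) := by
        refine setLIntegral_mono' measurableSet_Ioc fun t ht => ?_
        rw [← lintegral_const_mul _ hF, ← lintegral_indicator measurableSet_Ioc,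
          ← lintegral_indicator measurableSet_Ioc]
        refine lintegral_mono fun s => ?_
        by_cases hs : s ∈ Set.Ioc t 1
        · rw [Set.indicator_of_mem hs, Set.indicator_of_mem (Set.Ioc_subset_Ioc_left ht.1.le hs), hK,
            Set.indicator_of_mem (show (t, s) ∈ {q : ℝ × ℝ | q.1 < q.2} from hs.1)]
        · rw [Set.indicator_of_notMem hs]; exact zero_le
    _ = ∫⁻ s in Set.Ioc (0 : ℝ) 1, ∫⁻ t in Set.Ioc (0 : ℝ) 1, K (t, s) :=
        lintegral_lintegral_swap hKm.aemeasurable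
    _ ≤ _ := by
        refine setLIntegral_mono' measurableSet_Ioc fun s hs => ?_
        calc ∫⁻ t in Set.Ioc (0 : ℝ) 1, K (t, s)
            ≤ ∫⁻ t, (Set.Ioc 0 s).indicator (fun _ => ENNReal.ofReal (s ^ j) * F s) t := by
              rw [← lintegral_indicator measurableSet_Ioc]
              refine lintegral_mono fun t => ?_
              by_cases h0 : t ∈ Set.Ioc (0 : ℝ) 1
              · rw [Set.indicator_of_mem h0, hK]
                by_cases h : t < s
                · rw [Set.indicator_of_mem (show (t, s) ∈ {q : ℝ × ℝ | q.1 < q.2} from h),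
                    Set.indicator_of_mem (show t ∈ Set.Ioc 0 s from ⟨h0.1, h.le⟩)]
                  have := h0.1.le
                  dsimp only
                  gcongr
                · rw [Set.indicator_of_notMem
                    (show (t, s) ∉ {q : ℝ × ℝ | q.1 < q.2} from h)]
                  exact zero_le
              · rw [Set.indicator_of_notMem h0]; exact zero_le
          _ = _ := by
              rw [lintegral_indicator measurableSet_Ioc, setLIntegral_const, Real.volume_Ioc,
                sub_zero, pow_succ, ENNReal.ofReal_mul (by have := hs.1; positivity)]
              ring

theorem weightedMean_le (hg : TorusContDiff 1 g) (x : Fin n → ℝ) (j : ℕ) :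
    weightedMean j g x ≤
      cubeMean g x 1 + ∑ i, weightedMean (j + 1) (torusPartialDeriv i g) x := by
  have hm : ∀ i, Measurable (cubeMean (torusPartialDeriv i g) x) := fun i =>
    measurable_cubeMean (hg.torusPartialDeriv (k := 0) (by simp) i).continuous x
  have hpow : ∀ j : ℕ, Measurable fun t : ℝ => ENNReal.ofReal (t ^ j) := fun j => by fun_prop
  calc weightedMean j g x
      ≤ ∫⁻ t in Set.Ioc (0 : ℝ) 1, (cubeMean g x 1 + ENNReal.ofReal (t ^ j) *
          ∫⁻ s in Set.Ioc t 1, ∑ i, cubeMean (torusPartialDeriv i g) x s) := by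
        refine setLIntegral_mono' measurableSet_Ioc fun t ht => ?_
        refine (mul_le_mul_right (cubeMean_le hg x ht.2) _).trans ?_
        rw [mul_add]
        refine add_le_add (mul_le_of_le_one_left zero_le ?_) le_rfl
        exact ENNReal.ofReal_le_one.2 (pow_le_one₀ ht.1.le ht.2)
    _ = cubeMean g x 1 + ∫⁻ t in Set.Ioc (0 : ℝ) 1, ENNReal.ofReal (t ^ j) *
          ∫⁻ s in Set.Ioc t 1, ∑ i, cubeMean (torusPartialDeriv i g) x s := by
        rw [lintegral_add_left measurable_const]
        simp
    _ ≤ cubeMean g x 1 + ∫⁻ s in Set.Ioc (0 : ℝ) 1, ENNReal.ofReal (s ^ (j + 1)) *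
          ∑ i, cubeMean (torusPartialDeriv i g) x s := by
        refine add_le_add le_rfl ?_
        exact lintegral_pow_mul_tail_le j (Finset.measurable_sum _ fun i _ => hm i)
    _ = _ := by
        simp_rw [Finset.mul_sum]
        rw [lintegral_finsetSum _ fun i _ => by exact (hpow (j + 1)).mul (hm i)]
        rfl

/-- At t = 0 the cube shrinks to its corner, and the mean becomes the point value. -/
theorem enorm_torusMk_le (hg : TorusContDiff 1 g) (x : Fin n → ℝ) :
    ‖g (torusMk x)‖ₑ ≤ cubeMean g x 1 + ∑ i, weightedMean 0 (torusPartialDeriv i g) x := by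
  have h := cubeMean_le hg x zero_le_one
  rw [cubeMean_zero] at h
  refine h.trans (add_le_add le_rfl ?_)
  rw [lintegral_finsetSum _ fun i _ =>
    measurable_cubeMean (hg.torusPartialDeriv (k := 0) (by simp) i).continuous x]
  simp [weightedMean]

/-- The sum of the `q`-th powers of the `L^q` norms of the iterated partial derivatives of order
at most `m`. -/
noncomputable def sobolevSum (q : ℝ) : ℕ → (UnitAddTorus (Fin n) → ℂ) → ℝ≥0∞
  | 0, g => ∫⁻ z, ‖g z‖ₑ ^ q ∂torusMeasure n
  | m + 1, g => ∫⁻ z, ‖g z‖ₑ ^ q ∂torusMeasure n + ∑ i, sobolevSum q m (torusPartialDeriv i g)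

theorem eLpNorm'_rpow_self {α : Type*} [MeasurableSpace α] {μ : Measure α} {q : ℝ} (hq : 0 < q)
    (f : α → ℂ) : eLpNorm' f q μ ^ q = ∫⁻ a, ‖f a‖ₑ ^ q ∂μ := by
  rw [eLpNorm', ← ENNReal.rpow_mul, one_div_mul_cancel hq.ne', ENNReal.rpow_one]

theorem add_sum_rpow_le {ι : Type*} [Fintype ι] {q : ℝ} (hq : 1 ≤ q) (a A : ℝ≥0∞)
    (b B : ι → ℝ≥0∞) (C : ℝ≥0∞) (ha : a ^ q ≤ A) (hb : ∀ i, b i ^ q ≤ C * B i) :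
    (a + ∑ i, b i) ^ q ≤
      (2 ^ (q - 1) * (1 + (Fintype.card ι : ℝ≥0∞) ^ (q - 1) * C)) * (A + ∑ i, B i) := by
  calc (a + ∑ i, b i) ^ q ≤ 2 ^ (q - 1) * (a ^ q + (∑ i, b i) ^ q) :=
        ENNReal.rpow_add_le_mul_rpow_add_rpow _ _ hq
    _ ≤ 2 ^ (q - 1) * (A + (Fintype.card ι : ℝ≥0∞) ^ (q - 1) * (C * ∑ i, B i)) := by
        gcongr
        refine (ENNReal.rpow_sum_le_const_mul_sum_rpow Finset.univ b hq).trans ?_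
        rw [Finset.mul_sum Finset.univ B C, Finset.card_univ]
        gcongr with i
        exact hb i
    _ ≤ 2 ^ (q - 1) * ((1 + (Fintype.card ι : ℝ≥0∞) ^ (q - 1) * C) * (A + ∑ i, B i)) := by
        gcongr
        rw [add_mul, one_mul, mul_assoc]
        gcongr
        · exact le_self_add
        · exact le_add_self
    _ = _ := by ring

/-- Each derivative spent raises the weight exponent by one. When none is left, Hölder leaves ∫₀¹
t^{j - n/q} dt, which is finite because j - n/q > -1. -/
theorem weightedMean_rpow_le_sobolevSum {q : ℝ} (hq : 1 ≤ q) (m : ℕ) :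
    ∀ j : ℕ, n / q < j + 1 + m → ∃ C : ℝ≥0∞, C ≠ ⊤ ∧
      ∀ g : UnitAddTorus (Fin n) → ℂ, TorusContDiff m g → ∀ x,
        weightedMean j g x ^ q ≤ C * sobolevSum q m g := by
  have hq0 : 0 < q := by linarith
  induction m with
  | zero =>
    intro j hj
    refine ⟨(∫⁻ t in Set.Ioc (0 : ℝ) 1, ENNReal.ofReal (t ^ (j - n / q : ℝ))) ^ q,
      ENNReal.rpow_ne_top_of_nonneg hq0.le ?_, fun g hg x => ?_⟩
    · have h : IntegrableOn (fun t : ℝ => t ^ (j - n / q : ℝ)) (Set.Ioc 0 1) :=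
        (intervalIntegrable_iff_integrableOn_Ioc_of_le zero_le_one).1
          (intervalIntegral.intervalIntegrable_rpow' (by simp at hj; linarith))
      exact h.lintegral_lt_top.ne
    · rw [sobolevSum, ← eLpNorm'_rpow_self hq0, ← ENNReal.mul_rpow_of_nonneg _ _ hq0.le]
      refine ENNReal.rpow_le_rpow ?_ hq0.le
      rw [← lintegral_mul_const _ (by fun_prop)]
      refine setLIntegral_mono' measurableSet_Ioc fun t ht => ?_
      refine (mul_le_mul_right (cubeMean_le_eLpNorm' hg.continuous x hq ht) _).trans ?_
      rw [← mul_assoc, ← ENNReal.ofReal_mul (by have := ht.1; positivity), sub_eq_add_neg,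
        Real.rpow_add ht.1, Real.rpow_natCast]
  | succ m ih =>
    intro j hj
    -- The sum of the weight exponent and the number of remaining derivatives is preserved, so the
    -- condition on n/q passes to the induction hypothesis.
    obtain ⟨C, hC, h⟩ := ih (j + 1) (by push_cast at hj ⊢; linarith)
    refine ⟨2 ^ (q - 1) * (1 + (Fintype.card (Fin n) : ℝ≥0∞) ^ (q - 1) * C), ?_,
      fun g hg x => ?_⟩
    · have := sub_nonneg.2 hq
      finiteness
    · have h1 : TorusContDiff 1 g := hg.of_le (by norm_cast; omega)
      refine (ENNReal.rpow_le_rpow (weightedMean_le h1 x j) hq0.le).trans ?_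
      refine add_sum_rpow_le hq _ _ _ _ C ?_ fun i => h _ (hg.torusPartialDeriv (by norm_cast) i) x
      rw [← eLpNorm'_rpow_self hq0]
      exact ENNReal.rpow_le_rpow (cubeMean_one_le_eLpNorm' hg.continuous x hq) hq0.le

/-- The Sobolev embedding `W^{m+1,q}(𝕋ⁿ) ⊆ L^∞(𝕋ⁿ)` for `m + 1 > n / q`. -/
theorem enorm_rpow_le_sobolevSum {q : ℝ} (hq : 1 ≤ q) {m : ℕ} (hm : n / q < m + 1) :
    ∃ C : ℝ≥0∞, C ≠ ⊤ ∧ ∀ g : UnitAddTorus (Fin n) → ℂ,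
      TorusContDiff ((m + 1 : ℕ) : WithTop ℕ∞) g →
        ∀ z, ‖g z‖ₑ ^ q ≤ C * sobolevSum q (m + 1) g := by
  have hq0 : 0 < q := by linarith
  obtain ⟨C, hC, h⟩ := weightedMean_rpow_le_sobolevSum (n := n) hq m 0 (by simpa [add_comm] using hm)
  refine ⟨2 ^ (q - 1) * (1 + (Fintype.card (Fin n) : ℝ≥0∞) ^ (q - 1) * C), ?_, fun g hg z => ?_⟩
  · have := sub_nonneg.2 hq
    finiteness
  · obtain ⟨x, rfl⟩ := surjective_torusMk z
    have h1 : TorusContDiff 1 g := hg.of_le (by norm_cast; omega)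
    refine (ENNReal.rpow_le_rpow (enorm_torusMk_le h1 x) hq0.le).trans ?_
    refine add_sum_rpow_le hq _ _ _ _ C ?_ fun i => h _ (hg.torusPartialDeriv (by norm_cast) i) x
    rw [← eLpNorm'_rpow_self hq0]
    exact ENNReal.rpow_le_rpow (cubeMean_one_le_eLpNorm' hg.continuous x hq) hq0.le

end Sobolev

/-! ### From bounds uniform in the parameter to the diagonal -/

section DiagonalEstimate

variable {n : ℕ} {X ι : Type*} [MeasurableSpace X] {μ : Measure X} {s : Finset ι}
  {G : ι → X → ℂ}

theorem aemeasurable_lintegral_sum_rpow [SFinite μ] (q : ℝ)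
    (hG : ∀ ξ ∈ s, AEStronglyMeasurable (G ξ) μ) {b : ι → UnitAddTorus (Fin n) → ℂ}
    (hb : ∀ ξ ∈ s, Continuous (b ξ)) :
    AEMeasurable (Function.uncurry fun x z => ‖∑ ξ ∈ s, G ξ x * b ξ z‖ₑ ^ q)
      (μ.prod (torusMeasure n)) := by
  have : AEStronglyMeasurable (fun r : X × UnitAddTorus (Fin n) => ∑ ξ ∈ s, G ξ r.1 * b ξ r.2)
      (μ.prod (torusMeasure n)) :=
    Finset.aestronglyMeasurable_fun_sum _ fun ξ hξ =>
      (hG ξ hξ).comp_fst.mul ((hb ξ hξ).aestronglyMeasurable.comp_snd)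
  exact this.enorm.pow_const q

omit [MeasurableSpace X] in
theorem torusPartialDeriv_sum_mul' {b : ι → UnitAddTorus (Fin n) → ℂ} {m : ℕ}
    (hb : ∀ ξ ∈ s, TorusContDiff ((m + 1 : ℕ) : WithTop ℕ∞) (b ξ)) (x : X) (i : Fin n) :
    torusPartialDeriv i (fun z => ∑ ξ ∈ s, G ξ x * b ξ z) =
      fun z => ∑ ξ ∈ s, G ξ x * torusPartialDeriv i (b ξ) z :=
  torusPartialDeriv_sum_mul (fun ξ hξ => (hb ξ hξ).differentiable (by norm_cast; omega)) _ i

theorem aemeasurable_sobolevSum [SFinite μ] (q : ℝ)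
    (hG : ∀ ξ ∈ s, AEStronglyMeasurable (G ξ) μ) (m : ℕ) :
    ∀ b : ι → UnitAddTorus (Fin n) → ℂ, (∀ ξ ∈ s, TorusContDiff m (b ξ)) →
      AEMeasurable (fun x => sobolevSum q m fun z => ∑ ξ ∈ s, G ξ x * b ξ z) μ := by
  induction m with
  | zero =>
    intro b hb
    exact (aemeasurable_lintegral_sum_rpow q hG fun ξ hξ =>
      (hb ξ hξ).continuous).lintegral_prod_right'
  | succ m ih =>
    intro b hb
    refine AEMeasurable.add (aemeasurable_lintegral_sum_rpow q hG fun ξ hξ =>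
      (hb ξ hξ).continuous).lintegral_prod_right' (Finset.aemeasurable_fun_sum _ fun i _ => ?_)
    simp_rw [torusPartialDeriv_sum_mul' hb]
    exact ih _ fun ξ hξ => (hb ξ hξ).torusPartialDeriv (by norm_cast) i

theorem lintegral_lintegral_sum_rpow_le [SFinite μ] (q : ℝ)
    (hG : ∀ ξ ∈ s, AEStronglyMeasurable (G ξ) μ) {b : ι → UnitAddTorus (Fin n) → ℂ}
    (hb : ∀ ξ ∈ s, Continuous (b ξ)) {K : ℝ≥0∞}
    (hK : ∀ z, ∫⁻ x, ‖∑ ξ ∈ s, G ξ x * b ξ z‖ₑ ^ q ∂μ ≤ K) :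
    ∫⁻ x, ∫⁻ z, ‖∑ ξ ∈ s, G ξ x * b ξ z‖ₑ ^ q ∂torusMeasure n ∂μ ≤ K := by
  rw [lintegral_lintegral_swap (aemeasurable_lintegral_sum_rpow q hG hb)]
  exact (lintegral_mono hK).trans (by simp)

/-- `sobolevSum` has one term for each word of length at most m in n letters, and 1 + n(n+1)^m ≤
(n+1)^{m+1}. Each term is bounded by K after exchanging the integrals in x and z. -/
theorem lintegral_sobolevSum_le [SFinite μ] (q : ℝ)
    (hG : ∀ ξ ∈ s, AEStronglyMeasurable (G ξ) μ) {K : ℝ≥0∞} (m : ℕ) :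
    ∀ b : ι → UnitAddTorus (Fin n) → ℂ, (∀ ξ ∈ s, TorusContDiff m (b ξ)) →
      (∀ l : List (Fin n), l.length ≤ m → ∀ z,
        ∫⁻ x, ‖∑ ξ ∈ s, G ξ x * listDeriv l (b ξ) z‖ₑ ^ q ∂μ ≤ K) →
      ∫⁻ x, sobolevSum q m (fun z => ∑ ξ ∈ s, G ξ x * b ξ z) ∂μ ≤ ((n + 1 : ℕ) : ℝ≥0∞) ^ m * K := by
  induction m with
  | zero =>
    intro b hb hK
    simpa [sobolevSum] using
      lintegral_lintegral_sum_rpow_le q hG (fun ξ hξ => (hb ξ hξ).continuous) (hK [] le_rfl)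
  | succ m ih =>
    intro b hb hK
    have hb' : ∀ i, ∀ ξ ∈ s, TorusContDiff m (torusPartialDeriv i (b ξ)) := fun i ξ hξ =>
      (hb ξ hξ).torusPartialDeriv (by norm_cast) i
    simp_rw [sobolevSum, torusPartialDeriv_sum_mul' hb]
    rw [lintegral_add_left' (by exact (aemeasurable_lintegral_sum_rpow q hG fun ξ hξ =>
      (hb ξ hξ).continuous).lintegral_prod_right'),
      lintegral_finsetSum' _ fun i _ => aemeasurable_sobolevSum q hG m _ (hb' i)]
    have h0 := lintegral_lintegral_sum_rpow_le q hG (fun ξ hξ => (hb ξ hξ).continuous)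
      (hK [] (Nat.zero_le _))
    have h1 : ∀ i : Fin n, ∫⁻ x, sobolevSum q m
        (fun z => ∑ ξ ∈ s, G ξ x * torusPartialDeriv i (b ξ) z) ∂μ ≤
          ((n + 1 : ℕ) : ℝ≥0∞) ^ m * K := by
      refine fun i => ih _ (hb' i) fun l hl z => ?_
      -- The last entry of a list is the derivative applied first.
      have := hK (l ++ [i]) (by simpa using hl) z
      simpa [listDeriv] using this
    have hone : (1 : ℝ≥0∞) ≤ ((n + 1 : ℕ) : ℝ≥0∞) ^ m := by
      apply one_le_pow_of_one_le'
      norm_cast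
      omega
    calc _ ≤ K + ∑ _i : Fin n, ((n + 1 : ℕ) : ℝ≥0∞) ^ m * K :=
          add_le_add h0 (Finset.sum_le_sum fun i _ => h1 i)
      _ ≤ ((n + 1 : ℕ) : ℝ≥0∞) ^ m * K + ∑ _i : Fin n, ((n + 1 : ℕ) : ℝ≥0∞) ^ m * K :=
          add_le_add (le_mul_of_one_le_left zero_le hone) le_rfl
      _ = _ := by
          rw [Finset.sum_const, Finset.card_univ, Fintype.card_fin, nsmul_eq_mul]
          push_cast
          ring

/-- An `L^q` bound for the restriction to the diagonal of a function that depends smoothly on a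
parameter in the torus, in terms of bounds that are uniform in the parameter. -/
theorem lintegral_diagonal_le {q : ℝ} (hq : 1 ≤ q) {m : ℕ} (hm : n / q < m + 1) :
    ∃ C : ℝ≥0∞, C ≠ ⊤ ∧ ∀ {ι : Type} (s : Finset ι) (G : ι → UnitAddTorus (Fin n) → ℂ)
      (b : ι → UnitAddTorus (Fin n) → ℂ) (K : ℝ≥0∞),
      (∀ ξ ∈ s, AEStronglyMeasurable (G ξ) (torusMeasure n)) →
      (∀ ξ ∈ s, TorusContDiff ((m + 1 : ℕ) : WithTop ℕ∞) (b ξ)) →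
      (∀ l : List (Fin n), l.length ≤ m + 1 → ∀ z,
        ∫⁻ x, ‖∑ ξ ∈ s, G ξ x * listDeriv l (b ξ) z‖ₑ ^ q ∂torusMeasure n ≤ K) →
      ∫⁻ x, ‖∑ ξ ∈ s, G ξ x * b ξ x‖ₑ ^ q ∂torusMeasure n ≤ C * K := by
  obtain ⟨C, hC, h⟩ := enorm_rpow_le_sobolevSum hq hm
  refine ⟨C * ((n + 1 : ℕ) : ℝ≥0∞) ^ (m + 1), by finiteness, fun s G b K hG hb hK => ?_⟩
  calc ∫⁻ x, ‖∑ ξ ∈ s, G ξ x * b ξ x‖ₑ ^ q ∂torusMeasure n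
      ≤ ∫⁻ x, C * sobolevSum q (m + 1) (fun z => ∑ ξ ∈ s, G ξ x * b ξ z) ∂torusMeasure n :=
        lintegral_mono fun x =>
          h _ (TorusContDiff.sum fun ξ hξ => (hb ξ hξ).const_mul (G ξ x)) x
    _ ≤ C * (((n + 1 : ℕ) : ℝ≥0∞) ^ (m + 1) * K) := by
        rw [lintegral_const_mul' _ _ hC]
        gcongr
        exact lintegral_sobolevSum_le q hG (m + 1) b hb hK
    _ = _ := (mul_assoc _ _ _).symm

end DiagonalEstimate

/-! ### Summability of the Fourier coefficients of smooth functions -/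

section FourierDecay

variable {n : ℕ} {g : UnitAddTorus (Fin n) → ℂ}

open UnitAddTorus in
theorem mFourier_apply_add (ξ : Fin n → ℤ) (x y : UnitAddTorus (Fin n)) :
    mFourier ξ (x + y) = mFourier ξ x * mFourier ξ y := by
  simp [mFourier, fourier_apply, smul_add, AddCircle.toCircle_add, Finset.prod_mul_distrib]

open UnitAddTorus in
theorem mFourier_torusMk (ξ : Fin n → ℤ) (x : Fin n → ℝ) :
    mFourier ξ (torusMk x) = ∏ i, Complex.exp (2 * Real.pi * Complex.I * ξ i * x i) := by
  simp [mFourier, torusMk, -fourier_apply, fourier_coe_apply]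

open UnitAddTorus in
theorem mFourier_single_coe (ξ : Fin n → ℤ) (i : Fin n) (t : ℝ) :
    mFourier ξ (Pi.single i (t : UnitAddCircle)) =
      Complex.exp (2 * Real.pi * Complex.I * ξ i * t) := by
  rw [← torusMk_single, mFourier_torusMk, Finset.prod_eq_single i]
  · simp
  · intro j _ hj; simp [hj]
  · simp

open UnitAddTorus in
theorem torusContDiff_mFourier (m : WithTop ℕ∞) (ξ : Fin n → ℤ) :
    TorusContDiff m (mFourier ξ) := by
  have : (fun x : Fin n → ℝ => mFourier ξ (fun i => (x i : UnitAddCircle))) =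
      fun x => ∏ i, Complex.exp (2 * Real.pi * Complex.I * ξ i * x i) :=
    funext fun x => mFourier_torusMk ξ x
  unfold TorusContDiff
  rw [this]
  refine contDiff_prod fun i _ => ContDiff.cexp (contDiff_const.mul ?_)
  exact Complex.ofRealCLM.contDiff.comp (contDiff_apply ℝ ℝ i)

theorem integrable_torus_of_continuous (hg : Continuous g) : Integrable g (torusMeasure n) :=
  hg.integrable_of_hasCompactSupport (HasCompactSupport.of_compactSpace g)

theorem exists_bound_of_continuous_torus (hg : Continuous g) : ∃ C, ∀ z, ‖g z‖ ≤ C := by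
  obtain ⟨C, hC⟩ := isCompact_univ.exists_bound_of_continuousOn hg.continuousOn
  exact ⟨C, fun z => hC z trivial⟩

open UnitAddTorus in
theorem mFourierCoeff_eq (g : UnitAddTorus (Fin n) → ℂ) (ξ : Fin n → ℤ) :
    mFourierCoeff g ξ = ∫ z, mFourier (-ξ) z * g z ∂torusMeasure n := rfl

open UnitAddTorus in
theorem mFourierCoeff_translate (ξ : Fin n → ℤ) (i : Fin n) (t : ℝ) :
    mFourierCoeff (fun z => g (z + Pi.single i (t : UnitAddCircle))) ξ =
      Complex.exp (2 * Real.pi * Complex.I * ξ i * t) * mFourierCoeff g ξ := by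
  rw [mFourierCoeff_eq, mFourierCoeff_eq, ← integral_const_mul,
    ← integral_add_right_eq_self (fun z => Complex.exp (2 * Real.pi * Complex.I * ξ i * t) *
      (mFourier (-ξ) z * g z)) (Pi.single i (t : UnitAddCircle))]
  refine integral_congr_ae (.of_forall fun z => ?_)
  simp only [mFourier_apply_add, mFourier_single_coe, Pi.neg_apply]
  have : Complex.exp (2 * Real.pi * Complex.I * ξ i * t) *
      Complex.exp (2 * Real.pi * Complex.I * ((-ξ i : ℤ) : ℂ) * t) = 1 := by
    rw [← Complex.exp_add]
    simp
  linear_combination (- (mFourier (-ξ) z * g (z + Pi.single i (t : UnitAddCircle)))) * this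

theorem hasDerivAt_torus_single (hg : Differentiable ℝ (g ∘ torusMk)) (i : Fin n)
    (z : UnitAddTorus (Fin n)) (t : ℝ) :
    HasDerivAt (fun t : ℝ => g (z + Pi.single i (t : UnitAddCircle)))
      (torusPartialDeriv i g (z + Pi.single i (t : UnitAddCircle))) t := by
  have h := (differentiableAt_torus_single hg i
    (z + Pi.single i (t : UnitAddCircle))).hasDerivAt
  have h2 := HasDerivAt.comp_sub_const (x := t) t (f := fun s : ℝ =>
    g (z + Pi.single i (t : UnitAddCircle) + Pi.single i (s : UnitAddCircle))) (by rw [sub_self]; exact h)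
  have e : (fun s : ℝ => g (z + Pi.single i (s : UnitAddCircle))) = fun s : ℝ =>
      g (z + Pi.single i (t : UnitAddCircle) + Pi.single i ((s - t : ℝ) : UnitAddCircle)) := by
    ext s
    rw [add_assoc, ← Pi.single_add, ← AddCircle.coe_add, add_sub_cancel]
  rw [e]
  exact h2

open UnitAddTorus in
-- Instead of integrating by parts, the identity for the coefficients of a translate is
-- differentiated at t = 0, under the integral sign on one side.
theorem mFourierCoeff_torusPartialDeriv (hg : TorusContDiff 1 g) (ξ : Fin n → ℤ) (i : Fin n) :
    mFourierCoeff (torusPartialDeriv i g) ξ =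
      2 * Real.pi * Complex.I * ξ i * mFourierCoeff g ξ := by
  have hd := hg.differentiable le_rfl
  have hc : Continuous (torusPartialDeriv i g) :=
    (hg.torusPartialDeriv (k := 0) (by simp) i).continuous
  obtain ⟨C, hC⟩ := exists_bound_of_continuous_torus hc
  have hF : ∀ {h : UnitAddTorus (Fin n) → ℂ}, Continuous h → ∀ t : ℝ, Continuous fun z =>
      mFourier (-ξ) z * h (z + Pi.single i (t : UnitAddCircle)) := fun hh t =>
    (mFourier (-ξ)).continuous.mul (hh.comp (continuous_id.add continuous_const))
  have hle : ∀ z, ‖mFourier (-ξ) z‖ ≤ 1 := fun z =>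
    ((mFourier (-ξ)).norm_coe_le_norm z).trans mFourier_norm.le
  have hbound : ∀ z, ∀ t ∈ Set.univ (α := ℝ), ‖mFourier (-ξ) z *
      torusPartialDeriv i g (z + Pi.single i (t : UnitAddCircle))‖ ≤ C := fun z t _ => by
    rw [norm_mul]
    exact (mul_le_of_le_one_left (norm_nonneg _) (hle z)).trans (hC _)
  have hderiv : ∀ z, ∀ t ∈ Set.univ (α := ℝ), HasDerivAt (fun t : ℝ => mFourier (-ξ) z *
      g (z + Pi.single i (t : UnitAddCircle))) (mFourier (-ξ) z *
      torusPartialDeriv i g (z + Pi.single i (t : UnitAddCircle))) t := fun z t _ =>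
    (hasDerivAt_torus_single hd i z t).const_mul _
  have h0 : ∀ t₀ : ℝ, HasDerivAt (fun t : ℝ => ∫ z, mFourier (-ξ) z *
      g (z + Pi.single i (t : UnitAddCircle)) ∂torusMeasure n)
      (∫ z, mFourier (-ξ) z *
        torusPartialDeriv i g (z + Pi.single i (t₀ : UnitAddCircle)) ∂torusMeasure n) t₀ :=
    fun t₀ => (hasDerivAt_integral_of_dominated_loc_of_deriv_le (bound := fun _ => C)
      Filter.univ_mem (.of_forall fun t => (hF hg.continuous t).aestronglyMeasurable)
      (integrable_torus_of_continuous (hF hg.continuous t₀))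
      (hF hc t₀).aestronglyMeasurable (.of_forall hbound) (integrable_const C)
      (.of_forall hderiv)).2
  have h1 := h0 0
  have h2 : HasDerivAt (fun t : ℝ =>
      Complex.exp (2 * Real.pi * Complex.I * ξ i * t) * mFourierCoeff g ξ)
      (2 * Real.pi * Complex.I * ξ i * mFourierCoeff g ξ) 0 := by
    have h3 : HasDerivAt (fun t : ℝ => 2 * Real.pi * Complex.I * ξ i * (t : ℂ))
        (2 * Real.pi * Complex.I * ξ i) 0 := by
      simpa using (Complex.ofRealCLM.hasDerivAt (x := (0 : ℝ))).const_mul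
        (2 * Real.pi * Complex.I * ξ i)
    simpa using h3.cexp.mul_const (mFourierCoeff g ξ)
  have h4 : (fun t : ℝ => ∫ z, mFourier (-ξ) z * g (z + Pi.single i (t : UnitAddCircle))
      ∂torusMeasure n) = fun t : ℝ =>
      Complex.exp (2 * Real.pi * Complex.I * ξ i * t) * mFourierCoeff g ξ :=
    funext fun t => (mFourierCoeff_eq _ _).symm.trans (mFourierCoeff_translate ξ i t)
  rw [h4] at h1
  simpa [mFourierCoeff_eq] using h1.unique h2

open UnitAddTorus in
-- The witness is the product of the operators 1 - ∂_i² over i in s, applied to g; each multiplies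
-- the coefficients by 1 + (2πξ_i)².
theorem exists_mFourierCoeff_eq_prod_mul (hg : TorusContDiff ∞ g) (s : Finset (Fin n)) :
    ∃ h : UnitAddTorus (Fin n) → ℂ, TorusContDiff ∞ h ∧ ∀ ξ : Fin n → ℤ,
      mFourierCoeff h ξ = ((∏ i ∈ s, (1 + (2 * Real.pi * ξ i) ^ 2) : ℝ) : ℂ) * mFourierCoeff g ξ := by
  induction s using Finset.induction_on with
  | empty => exact ⟨g, hg, by simp⟩
  | insert i s hi ih =>
    obtain ⟨h, hh, hcoeff⟩ := ih
    have h1 : TorusContDiff ∞ (torusPartialDeriv i h) := hh.torusPartialDeriv (by simp) i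
    have h2 : TorusContDiff ∞ (torusPartialDeriv i (torusPartialDeriv i h)) :=
      h1.torusPartialDeriv (by simp) i
    refine ⟨fun z => h z - torusPartialDeriv i (torusPartialDeriv i h) z, hh.sub h2, fun ξ => ?_⟩
    have hsub : mFourierCoeff (fun z => h z - torusPartialDeriv i (torusPartialDeriv i h) z) ξ =
        mFourierCoeff h ξ - mFourierCoeff (torusPartialDeriv i (torusPartialDeriv i h)) ξ := by
      simp only [mFourierCoeff_eq, mul_sub]
      exact integral_sub
        (integrable_torus_of_continuous ((mFourier (-ξ)).continuous.mul hh.continuous))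
        (integrable_torus_of_continuous ((mFourier (-ξ)).continuous.mul h2.continuous))
    rw [hsub, mFourierCoeff_torusPartialDeriv (h1.of_le (by simp)),
      mFourierCoeff_torusPartialDeriv (hh.of_le (by simp)), hcoeff, Finset.prod_insert hi]
    push_cast
    linear_combination (-(2 * Real.pi * ξ i : ℂ) ^ 2 * (∏ j ∈ s, (1 + (2 * Real.pi * ξ j : ℂ) ^ 2)) *
      mFourierCoeff g ξ) * Complex.I_sq

theorem summable_one_div_one_add_sq :
    Summable fun k : ℤ => (1 + (2 * Real.pi * k) ^ 2)⁻¹ := by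
  have h1 : Summable fun k : ℤ => 1 / (k : ℝ) ^ 2 :=
    Real.summable_one_div_int_pow.2 one_lt_two
  have h2 : Summable fun k : ℤ => if k = 0 then (1 : ℝ) else 0 :=
    (hasSum_ite_eq (0 : ℤ) (1 : ℝ)).summable
  refine Summable.of_nonneg_of_le (fun k => by positivity) (fun k => ?_) (h1.add h2)
  by_cases hk : k = 0
  · simp [hk]
  · have hk' : (0 : ℝ) < (k : ℝ) ^ 2 := by positivity
    simp only [hk, if_false, add_zero, one_div]
    refine inv_anti₀ hk' ?_
    have : 1 ≤ (2 * Real.pi) ^ 2 := by nlinarith [Real.pi_gt_three]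
    rw [mul_pow]
    nlinarith

/-- A finite set of indices lies in a box, over which the sum of products factors. -/
theorem summable_prod_apply {ι κ : Type*} [Fintype ι] {f : κ → ℝ} (hf0 : ∀ k, 0 ≤ f k)
    (hf : Summable f) : Summable fun ξ : ι → κ => ∏ i, f (ξ i) := by
  classical
  refine summable_of_sum_le (c := ∏ _i : ι, ∑' k, f k)
    (fun ξ => Finset.prod_nonneg fun i _ => hf0 _) fun S => ?_
  calc ∑ ξ ∈ S, ∏ i, f (ξ i)
      ≤ ∑ ξ ∈ Fintype.piFinset fun i => S.image fun ξ => ξ i, ∏ i, f (ξ i) := by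
        refine Finset.sum_le_sum_of_subset_of_nonneg (fun ξ hξ => ?_)
          fun ξ _ _ => Finset.prod_nonneg fun i _ => hf0 _
        exact Fintype.mem_piFinset.2 fun i => Finset.mem_image_of_mem _ hξ
    _ = ∏ i, ∑ k ∈ S.image fun ξ => ξ i, f k := by rw [Finset.prod_univ_sum]
    _ ≤ _ := Finset.prod_le_prod (fun i _ => Finset.sum_nonneg fun k _ => hf0 k)
        fun i _ => hf.sum_le_tsum _ fun k _ => hf0 k

open UnitAddTorus in
-- Boundedness of the coefficients of ∏(1 - ∂_i²)g gives the decay ∏(1 + (2πξ_i)²)^{-1}, which is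
-- summable as a product of one-dimensional series.
theorem summable_mFourierCoeff_of_torusContDiff (hg : TorusContDiff ∞ g) :
    Summable (mFourierCoeff g) := by
  obtain ⟨h, hh, hcoeff⟩ := exists_mFourierCoeff_eq_prod_mul hg Finset.univ
  obtain ⟨C, hC⟩ := exists_bound_of_continuous_torus hh.continuous
  have hbound : ∀ ξ, ‖mFourierCoeff h ξ‖ ≤ C := by
    intro ξ
    have := norm_integral_le_of_norm_le_const (μ := torusMeasure n) (C := C)
      (f := fun z => mFourier (-ξ) z * h z) (.of_forall fun z => by
        rw [norm_mul]
        refine (mul_le_of_le_one_left (norm_nonneg _) ?_).trans (hC _)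
        exact ((mFourier (-ξ)).norm_coe_le_norm z).trans mFourier_norm.le)
    simpa [mFourierCoeff_eq] using this
  refine Summable.of_norm_bounded ((summable_prod_apply (ι := Fin n)
    (fun k : ℤ => by positivity) summable_one_div_one_add_sq).mul_left C) fun ξ => ?_
  have hpos : 0 < ∏ i, (1 + (2 * Real.pi * ξ i) ^ 2) := Finset.prod_pos fun i _ => by positivity
  have h1 := hbound ξ
  rw [hcoeff, norm_mul, Complex.norm_real,
    Real.norm_of_nonneg hpos.le] at h1
  rw [Finset.prod_inv_distrib, ← div_eq_mul_inv, le_div_iff₀ hpos, mul_comm]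
  exact h1

end FourierDecay

/-! ### Bounds on trigonometric polynomials and extension to L^p -/

section Extension

variable {n : ℕ}

/-- Along a cofinal sequence of finite sets the partial sums converge in L^p, hence almost
everywhere along a subsequence; the pointwise sum is the only possible limit. -/
theorem ae_eq_tsum_of_hasSum_Lp {X ι : Type*} [MeasurableSpace X] [Countable ι] {μ : Measure X}
    {p : ℝ≥0∞} [Fact (1 ≤ p)] {u : ι → Lp ℂ p μ} {U : Lp ℂ p μ} {v : ι → X → ℂ}
    (hU : HasSum u U) (huv : ∀ i, u i =ᵐ[μ] v i) (hv : ∀ x, Summable fun i => v i x) :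
    U =ᵐ[μ] fun x => ∑' i, v i x := by
  obtain ⟨S, hS⟩ := Filter.exists_seq_tendsto (Filter.atTop : Filter (Finset ι))
  have h1 : Filter.Tendsto (fun k => ∑ i ∈ S k, u i) Filter.atTop (nhds U) := hU.comp hS
  obtain ⟨ns, hns, h2⟩ := (tendstoInMeasure_of_tendsto_Lp h1).exists_seq_tendsto_ae
  have h3 : ∀ᵐ x ∂μ, ∀ k, (∑ i ∈ S k, u i : Lp ℂ p μ) x = ∑ i ∈ S k, v i x := by
    refine ae_all_iff.2 fun k => ?_
    filter_upwards [Lp.coeFn_finsetSum (S k) u, ae_all_iff.2 huv] with x hx hx'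
    rw [hx]
    simp [hx']
  filter_upwards [h2, h3] with x hx hx'
  simp only [hx'] at hx
  exact tendsto_nhds_unique hx ((hv x).hasSum.comp (hS.comp hns.tendsto_atTop))

open UnitAddTorus in
/-- The trigonometric polynomial with coefficients `c`. -/
noncomputable def trigPoly : ((Fin n → ℤ) →₀ ℂ) →ₗ[ℂ] C(UnitAddTorus (Fin n), ℂ) :=
  Finsupp.linearCombination ℂ mFourier

open UnitAddTorus in
theorem trigPoly_apply (c : (Fin n → ℤ) →₀ ℂ) (x : UnitAddTorus (Fin n)) :
    trigPoly c x = ∑ ξ ∈ c.support, c ξ * mFourier ξ x := by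
  simp [trigPoly, Finsupp.linearCombination_apply, Finsupp.sum, ContinuousMap.sum_apply]

theorem torusContDiff_trigPoly (m : WithTop ℕ∞) (c : (Fin n → ℤ) →₀ ℂ) :
    TorusContDiff m (trigPoly c) := by
  rw [show ⇑(trigPoly c) = _ from funext (trigPoly_apply c)]
  exact TorusContDiff.sum fun ξ _ => (torusContDiff_mFourier m ξ).const_mul (c ξ)

open UnitAddTorus in
theorem mFourierCoeff_trigPoly (c : (Fin n → ℤ) →₀ ℂ) (ξ : Fin n → ℤ) :
    mFourierCoeff (trigPoly c) ξ = c ξ := by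
  classical
  have h : ∀ m : Fin n → ℤ, mFourierCoeff (mFourier m) ξ = if m = ξ then 1 else 0 := by
    intro m
    rw [← mFourierCoeff_toLp, ← mFourierBasis_repr]
    have := congrFun (coe_mFourierBasis (d := Fin n)) m
    rw [← mFourierLp, ← this, HilbertBasis.repr_self, lp.single_apply, Pi.single_apply]
    simp [eq_comm]
  have e : mFourierCoeff (trigPoly c) ξ =
      ∑ m ∈ c.support, c m * mFourierCoeff (mFourier m) ξ := by
    simp only [mFourierCoeff_eq, trigPoly_apply, Finset.mul_sum]
    rw [integral_finsetSum _ fun m _ => integrable_torus_of_continuous (by fun_prop)]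
    refine Finset.sum_congr rfl fun m _ => ?_
    rw [← integral_const_mul]
    congr 1
    ext z
    ring
  rw [e]
  simp [h, eq_comm]

/-- The class in `L^p` of the trigonometric polynomial with coefficients `c`. -/
noncomputable def trigPolyLp (p : ℝ≥0∞) [Fact (1 ≤ p)] :
    ((Fin n → ℤ) →₀ ℂ) →ₗ[ℂ] Lp ℂ p (torusMeasure n) :=
  (ContinuousMap.toLp p (torusMeasure n) ℂ).toLinearMap ∘ₗ trigPoly

theorem trigPolyLp_apply (p : ℝ≥0∞) [Fact (1 ≤ p)] (c : (Fin n → ℤ) →₀ ℂ) :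
    trigPolyLp p c = ContinuousMap.toLp p (torusMeasure n) ℂ (trigPoly c) := rfl

theorem denseRange_trigPolyLp {p : ℝ≥0∞} [Fact (1 ≤ p)] (hp : p ≠ ⊤) :
    DenseRange (trigPolyLp (n := n) p) := by
  have h := UnitAddTorus.span_mFourierLp_closure_eq_top (d := Fin n) hp
  have e : LinearMap.range (trigPolyLp (n := n) p) =
      Submodule.span ℂ (Set.range (UnitAddTorus.mFourierLp (d := Fin n) p)) := by
    rw [trigPolyLp, trigPoly, LinearMap.range_comp, Finsupp.range_linearCombination,
      Submodule.map_span, ← Set.range_comp]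
    rfl
  rw [DenseRange, ← LinearMap.coe_range, Submodule.dense_iff_topologicalClosure_eq_top, e]
  exact h

variable {φ : UnitAddTorus (Fin n) → (Fin n → ℤ) → ℝ}

theorem fsoTerm_trigPoly (a : UnitAddTorus (Fin n) → (Fin n → ℤ) → ℂ) (c : (Fin n → ℤ) →₀ ℂ)
    (x : UnitAddTorus (Fin n)) (ξ : Fin n → ℤ) :
    fsoTerm φ a (trigPoly c) x ξ = Complex.exp (2 * Real.pi * Complex.I * φ x ξ) * a x ξ * c ξ := by
  rw [fsoTerm, mFourierCoeff_trigPoly]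

theorem tsum_fsoTerm_trigPoly (a : UnitAddTorus (Fin n) → (Fin n → ℤ) → ℂ)
    (c : (Fin n → ℤ) →₀ ℂ) (x : UnitAddTorus (Fin n)) :
    ∑' ξ, fsoTerm φ a (trigPoly c) x ξ =
      ∑ ξ ∈ c.support, Complex.exp (2 * Real.pi * Complex.I * φ x ξ) * a x ξ * c ξ := by
  simp_rw [fsoTerm_trigPoly]
  exact tsum_eq_sum fun ξ hξ => by simp [Finsupp.notMem_support_iff.1 hξ]

/-- The symbol norm controls the operator on trigonometric polynomials. -/
theorem eLpNorm_sum_le_of_fsoSymbolNorm_lt {p : ℝ≥0∞} [Fact (1 ≤ p)] {b : (Fin n → ℤ) → ℂ}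
    {M : ℝ≥0∞} (hb : fsoSymbolNorm p φ b < M) (c : (Fin n → ℤ) →₀ ℂ) :
    eLpNorm (fun x => ∑ ξ ∈ c.support, Complex.exp (2 * Real.pi * Complex.I * φ x ξ) * b ξ * c ξ)
      p (torusMeasure n) ≤ M * ‖trigPolyLp p c‖ₑ := by
  simp only [fsoSymbolNorm, iInf_lt_iff] at hb
  obtain ⟨T, hT, hM⟩ := hb
  have h := (hT (trigPoly c) (torusContDiff_trigPoly _ c)).2
  simp_rw [tsum_fsoTerm_trigPoly] at h
  rw [← eLpNorm_congr_ae h, ← Lp.enorm_def, ← trigPolyLp_apply]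
  exact (T.le_opENorm _).trans (by gcongr)

/-- The phase is not assumed measurable in x. Applying the extension to the character of frequency ξ
shows that e^{2πiφ(·,ξ)} b(ξ) is measurable, and b(ξ) can be divided out. -/
theorem aestronglyMeasurable_exp_phase {p : ℝ≥0∞} [Fact (1 ≤ p)] {b : (Fin n → ℤ) → ℂ}
    (hb : fsoSymbolNorm p φ b < ⊤) {ξ : Fin n → ℤ} (hξ : b ξ ≠ 0) :
    AEStronglyMeasurable (fun x => Complex.exp (2 * Real.pi * Complex.I * φ x ξ))
      (torusMeasure n) := by
  simp only [fsoSymbolNorm, iInf_lt_iff] at hb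
  obtain ⟨T, hT, -⟩ := hb
  have h := (hT (trigPoly (Finsupp.single ξ 1)) (torusContDiff_trigPoly _ _)).2
  have h2 : AEStronglyMeasurable (fun x => Complex.exp (2 * Real.pi * Complex.I * φ x ξ) * b ξ)
      (torusMeasure n) := by
    refine (Lp.aestronglyMeasurable _).congr (h.trans (.of_forall fun x => ?_))
    simp [tsum_fsoTerm_trigPoly]
  simpa [hξ] using h2.mul_const (b ξ)⁻¹

theorem listDeriv_zero (l : List (Fin n)) :
    listDeriv l (fun _ : UnitAddTorus (Fin n) => (0 : ℂ)) = fun _ => 0 := by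
  induction l with
  | nil => rfl
  | cons i l ih =>
    change torusPartialDeriv i (listDeriv l _) = _
    rw [ih]
    ext z
    simp [torusPartialDeriv]

/-- The operator bound on trigonometric polynomials for symbols depending on `x`. -/
theorem exists_eLpNorm_trigPoly_le {p : ℝ≥0∞} [Fact (1 ≤ p)] (hp_top : p ≠ ⊤) {m : ℕ}
    (hm : n / p.toReal < m + 1) {a : UnitAddTorus (Fin n) → (Fin n → ℤ) → ℂ}
    (ha : ∀ ξ, TorusContDiff ((m + 1 : ℕ) : WithTop ℕ∞) fun z => a z ξ) {M : ℝ≥0∞} (hM : M ≠ ⊤)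
    (hbound : ∀ l : List (Fin n), l.length ≤ m + 1 → ∀ z,
      fsoSymbolNorm p φ (fun ξ => listDeriv l (fun w => a w ξ) z) < M) :
    (∀ ξ, AEStronglyMeasurable (fun x => Complex.exp (2 * Real.pi * Complex.I * φ x ξ) * a x ξ)
      (torusMeasure n)) ∧
    ∃ C : ℝ≥0∞, C ≠ ⊤ ∧ ∀ c : (Fin n → ℤ) →₀ ℂ,
      eLpNorm (fun x => ∑ ξ ∈ c.support,
        c ξ * (Complex.exp (2 * Real.pi * Complex.I * φ x ξ) * a x ξ)) p (torusMeasure n) ≤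
          C * ‖trigPolyLp p c‖ₑ := by
  classical
  have hp1 : 1 ≤ p := Fact.out
  have hp0 : p ≠ 0 := (zero_lt_one.trans_le hp1).ne'
  have hq : 1 ≤ p.toReal := by
    simpa using ENNReal.toReal_mono hp_top hp1
  have hq0 : 0 < p.toReal := by linarith
  -- Where a(·,ξ) vanishes identically, nothing makes the exponential measurable, so it is replaced
  -- by 0; its products with a and the derivatives of a do not change.
  let G : (Fin n → ℤ) → UnitAddTorus (Fin n) → ℂ := fun ξ x =>
    if ∃ z, a z ξ ≠ 0 then Complex.exp (2 * Real.pi * Complex.I * φ x ξ) else 0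
  have hGm : ∀ ξ, AEStronglyMeasurable (G ξ) (torusMeasure n) := by
    intro ξ
    by_cases h : ∃ z, a z ξ ≠ 0
    · obtain ⟨z, hz⟩ := h
      simp only [G, show (∃ z, a z ξ ≠ 0) from ⟨z, hz⟩, if_true]
      exact aestronglyMeasurable_exp_phase ((hbound [] (Nat.zero_le _) z).trans_le le_top) hz
    · simp only [G, h, if_false]
      exact aestronglyMeasurable_const
  have hG : ∀ (l : List (Fin n)) (ξ x z), G ξ x * listDeriv l (fun w => a w ξ) z =
      Complex.exp (2 * Real.pi * Complex.I * φ x ξ) * listDeriv l (fun w => a w ξ) z := by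
    intro l ξ x z
    by_cases h : ∃ z, a z ξ ≠ 0
    · simp only [G, h, if_true]
    · have : (fun w => a w ξ) = fun _ => 0 := funext fun w => by
        by_contra hw; exact h ⟨w, hw⟩
      rw [this, listDeriv_zero]
      simp
  have hG0 : ∀ ξ x z, G ξ x * a z ξ =
      Complex.exp (2 * Real.pi * Complex.I * φ x ξ) * a z ξ := fun ξ x z => hG [] ξ x z
  refine ⟨fun ξ => ?_, ?_⟩
  · simp_rw [← hG0]
    exact (hGm ξ).mul (ha ξ).continuous.aestronglyMeasurable
  obtain ⟨C, hC, h⟩ := lintegral_diagonal_le (n := n) hq hm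
  refine ⟨C ^ (1 / p.toReal) * M, ?_, fun c => ?_⟩
  · exact ENNReal.mul_ne_top (ENNReal.rpow_ne_top_of_nonneg (by positivity) hC) hM
  have hconv : ∀ f : UnitAddTorus (Fin n) → ℂ, ∫⁻ x, ‖f x‖ₑ ^ p.toReal ∂torusMeasure n =
      eLpNorm f p (torusMeasure n) ^ p.toReal := fun f => by
    rw [eLpNorm_eq_eLpNorm' hp0 hp_top, eLpNorm'_rpow_self hq0]
  -- For frozen z each inner sum is an x-independent symbol applied to the same polynomial, so K =
  -- (M‖f‖)^p serves for all z and all derivatives.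
  have key := h c.support (fun ξ x => c ξ * G ξ x) (fun ξ z => a z ξ)
    ((M * ‖trigPolyLp p c‖ₑ) ^ p.toReal) (fun ξ _ => (hGm ξ).const_mul (c ξ)) (fun ξ _ => ha ξ)
    (fun l hl z => by
      rw [hconv]
      refine ENNReal.rpow_le_rpow ?_ hq0.le
      convert eLpNorm_sum_le_of_fsoSymbolNorm_lt (hbound l hl z) c using 4 with x ξ
      rw [mul_assoc, hG, mul_comm])
  rw [hconv] at key
  have key2 := ENNReal.rpow_le_rpow key (z := 1 / p.toReal) (by positivity)
  rw [ENNReal.mul_rpow_of_nonneg _ _ (by positivity), ← ENNReal.rpow_mul, ← ENNReal.rpow_mul,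
    mul_one_div_cancel hq0.ne', ENNReal.rpow_one, ENNReal.rpow_one, ← mul_assoc] at key2
  simpa only [mul_assoc, hG0] using key2

/-- An `x`-dependent symbol whose operator is bounded on trigonometric polynomials, and whose
series converge, has a bounded extension. -/
theorem exists_isFSOExtension {p : ℝ≥0∞} [Fact (1 ≤ p)] (hp_top : p ≠ ⊤)
    {a : UnitAddTorus (Fin n) → (Fin n → ℤ) → ℂ}
    (hmeas : ∀ ξ, AEStronglyMeasurable
      (fun x => Complex.exp (2 * Real.pi * Complex.I * φ x ξ) * a x ξ) (torusMeasure n))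
    {C : ℝ≥0∞} (hC : C ≠ ⊤)
    (hbound : ∀ c : (Fin n → ℤ) →₀ ℂ,
      eLpNorm (fun x => ∑ ξ ∈ c.support,
        c ξ * (Complex.exp (2 * Real.pi * Complex.I * φ x ξ) * a x ξ)) p (torusMeasure n) ≤
          C * ‖trigPolyLp p c‖ₑ)
    (hsum : ∀ f : C(UnitAddTorus (Fin n), ℂ), TorusContDiff ∞ f →
      ∀ x, Summable (fsoTerm φ a f x)) :
    ∃ T : Lp ℂ p (torusMeasure n) →L[ℂ] Lp ℂ p (torusMeasure n), IsFSOExtension φ a T := by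
  have hmem : ∀ ξ, MemLp (fun x => Complex.exp (2 * Real.pi * Complex.I * φ x ξ) * a x ξ)
      p (torusMeasure n) := by
    refine fun ξ => ⟨hmeas ξ, ?_⟩
    have := hbound (Finsupp.single ξ 1)
    simp only [Finsupp.support_single _ one_ne_zero, Finset.sum_singleton,
      Finsupp.single_eq_same, one_mul] at this
    exact this.trans_lt (ENNReal.mul_lt_top hC.lt_top enorm_lt_top)
  let F : (Fin n → ℤ) → Lp ℂ p (torusMeasure n) := fun ξ => (hmem ξ).toLp
  have hF : ∀ ξ (r : ℂ), ((r • F ξ : Lp ℂ p (torusMeasure n)) : UnitAddTorus (Fin n) → ℂ)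
      =ᵐ[torusMeasure n]
      fun x => r * (Complex.exp (2 * Real.pi * Complex.I * φ x ξ) * a x ξ) := by
    intro ξ r
    filter_upwards [Lp.coeFn_smul r (F ξ), (hmem ξ).coeFn_toLp] with x h1 h2
    rw [h1, Pi.smul_apply, h2, smul_eq_mul]
  let A : ((Fin n → ℤ) →₀ ℂ) →ₗ[ℂ] Lp ℂ p (torusMeasure n) := Finsupp.linearCombination ℂ F
  have hA : ∀ c, ‖A c‖ ≤ C.toReal * ‖trigPolyLp p c‖ := by
    intro c
    have e : A c =ᵐ[torusMeasure n] fun x => ∑ ξ ∈ c.support,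
        c ξ * (Complex.exp (2 * Real.pi * Complex.I * φ x ξ) * a x ξ) := by
      have : A c = ∑ ξ ∈ c.support, c ξ • F ξ := rfl
      rw [this]
      filter_upwards [Lp.coeFn_finsetSum c.support fun ξ => c ξ • F ξ,
        ae_all_iff.2 fun ξ => hF ξ (c ξ)] with x h1 h2
      rw [h1]
      simp [h2]
    have h := hbound c
    rw [← eLpNorm_congr_ae e, ← Lp.enorm_def] at h
    have h' := ENNReal.toReal_mono (ENNReal.mul_ne_top hC enorm_ne_top) h
    simpa using h'
  have hdense := denseRange_trigPolyLp (n := n) hp_top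
  have hTe := LinearMap.extendOfNorm_eq hdense ⟨C.toReal, hA⟩
  refine ⟨A.extendOfNorm (trigPolyLp p), fun f hf => ⟨hsum f hf, ?_⟩⟩
  -- The Fourier series of f converges uniformly, hence in L^p, and the continuous extension maps it
  -- term by term.
  have hseries := UnitAddTorus.hasSum_mFourier_series_of_summable
    (summable_mFourierCoeff_of_torusContDiff hf)
  have h1 := (hseries.mapL (ContinuousMap.toLp p (torusMeasure n) ℂ)).mapL
    (A.extendOfNorm (trigPolyLp p))
  have h2 : ∀ ξ, A.extendOfNorm (trigPolyLp p) (ContinuousMap.toLp p (torusMeasure n) ℂ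
      (UnitAddTorus.mFourierCoeff f ξ • UnitAddTorus.mFourier ξ)) =
        UnitAddTorus.mFourierCoeff f ξ • F ξ := by
    intro ξ
    have h3 := hTe (Finsupp.single ξ (UnitAddTorus.mFourierCoeff f ξ))
    simpa [A, trigPolyLp_apply, trigPoly] using h3
  simp only [h2] at h1
  have h4 := ae_eq_tsum_of_hasSum_Lp h1 (fun ξ => hF ξ _) (fun x => by
    refine (hsum f hf x).congr fun ξ => ?_
    rw [fsoTerm]; ring)
  refine h4.trans (.of_forall fun x => tsum_congr fun ξ => ?_)
  rw [fsoTerm]; ring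

end Extension

/-! ### Proof of the boundedness theorem -/

theorem mainTheorem3 (n : ℕ) (p : ℝ≥0∞) [Fact (1 ≤ p)] (hp_one : 1 < p) (hp_top : p < ⊤)
    (φ : UnitAddTorus (Fin n) → (Fin n → ℤ) → ℝ)
    (a : UnitAddTorus (Fin n) → (Fin n → ℤ) → ℂ)
    (ha : ∀ ξ, TorusContDiff ((⌊(n : ℝ) / p.toReal⌋₊ + 1 : ℕ) : WithTop ℕ∞) (fun z => a z ξ))
    (hbound : ∀ α : Fin n → ℕ, ∑ i, α i ≤ ⌊(n : ℝ) / p.toReal⌋₊ + 1 →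
      (⨆ z : UnitAddTorus (Fin n),
        fsoSymbolNorm p φ (fun ξ => torusDeriv α (fun w => a w ξ) z)) < ⊤) :
    ∃ T : Lp ℂ p (torusMeasure n) →L[ℂ] Lp ℂ p (torusMeasure n), IsFSOExtension φ a T := by
  set m := ⌊(n : ℝ) / p.toReal⌋₊ with hm
  have hlist : ∀ l : List (Fin n), l.length ≤ m + 1 →
      (⨆ z, fsoSymbolNorm p φ (fun ξ => listDeriv l (fun w => a w ξ) z)) < ⊤ := by
    intro l hl
    have h := hbound (fun i => l.count i) (by rwa [sum_count_eq_length])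
    have e : ∀ ξ, listDeriv l (fun w => a w ξ) = torusDeriv (fun i => l.count i) fun w => a w ξ :=
      fun ξ => listDeriv_eq_torusDeriv ((ha ξ).of_le (by exact_mod_cast hl))
    simpa only [e] using h
  have hfin : {l : List (Fin n) | l.length ≤ m + 1}.Finite := List.finite_length_le (Fin n) (m + 1)
  obtain ⟨M, hM, hMl⟩ : ∃ M : ℝ≥0∞, M ≠ ⊤ ∧ ∀ l : List (Fin n), l.length ≤ m + 1 → ∀ z,
      fsoSymbolNorm p φ (fun ξ => listDeriv l (fun w => a w ξ) z) < M := by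
    -- There are finitely many lists of bounded length, so the suprema can be summed; the added 1
    -- makes the inequality strict, which yields an actual extension of norm below M.
    refine ⟨∑ l ∈ hfin.toFinset,
      (⨆ z, fsoSymbolNorm p φ (fun ξ => listDeriv l (fun w => a w ξ) z)) + 1, ?_, ?_⟩
    · refine ENNReal.add_ne_top.2 ⟨(ENNReal.sum_lt_top.2 fun l hl => ?_).ne, ENNReal.one_ne_top⟩
      exact hlist l (by simpa using hl)
    · intro l hl z
      have h1 := le_iSup (fun z => fsoSymbolNorm p φ
        (fun ξ => listDeriv l (fun w => a w ξ) z)) z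
      have h2 := Finset.single_le_sum (f := fun l =>
        ⨆ z, fsoSymbolNorm p φ (fun ξ => listDeriv l (fun w => a w ξ) z))
        (fun _ _ => zero_le) (hfin.mem_toFinset.2 hl)
      refine (h1.trans h2).trans_lt (ENNReal.lt_add_right ?_ one_ne_zero)
      exact (ENNReal.sum_lt_top.2 fun l hl => hlist l (by simpa using hl)).ne
  obtain ⟨hmeas, C, hC, hle⟩ := exists_eLpNorm_trigPoly_le hp_top.ne
    (Nat.lt_floor_add_one _) ha hM hMl
  refine exists_isFSOExtension hp_top.ne hmeas hC hle fun f hf x => ?_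
  -- With no derivative and z = x, the x-independent symbol a(x,·) has at the point x the same
  -- series as a.
  have h0 := (hMl [] (Nat.zero_le _) x).trans_le le_top
  simp only [fsoSymbolNorm, iInf_lt_iff] at h0
  obtain ⟨T, hT, -⟩ := h0
  exact (hT f hf).1 x
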